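/- Let $1\le k\le n$. A tight frame is an ordered family $S=(v_1,\dots,v_n)$ of vectors of $\mathbb{R}^k$ with $\sum_{i=1}^n v_i\otimes v_i=I_k$; let $\Omega(n,k)$ be the set of all tight frames, with the metric $\operatorname{dist}(S,S')=\big(\sum_i|v_i-v_i'|^2\big)^{1/2}$, and let $$F(S)=\operatorname{vol}_k\Big(\sum_{i=1}^n[0,v_i]\Big)$$ be the volume of the zonotope of $S$ (a Minkowski sum of segments). For $i\in[n]$ and a $(k-1)$-element set $L=\{l_1<\dots<l_{k-1}\}\subset[n]$ put $d_S(\{i,L\})=\det(v_i,v_{l_1},\dots,v_{l_{k-1}})$. Equip $\Lambda^{k-1}(\mathbb{R}^n)$ with the standard inner product, for which the forms $e_L=e_{l_1}\wedge\dots\wedge e_{l_{k-1}}$ are an orthonormal basis, and set $$d_S(i)=\sum_{L}d_S(\{i,L\})\,e_L,\qquad \sigma_S(i)=\frac1{F(S)}\sum_{L}\operatorname{sign}\big(d_S(\{i,L\})\big)\,e_L ,$$ with $\operatorname{sign}(0)=0$, both sums over all $(k-1)$-element subsets $L$ of $[n]$. Let $P^S$ be the orthogonal projection of $\mathbb{R}^n$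 onto the span of the rows of the $k\times n$ matrix $(v_1,\dots,v_n)$, and $\wedge^{k-1}P^S$ its exterior power. Consider the system $$\wedge^{k-1}P^S(\sigma_S(i))=d_S(i)\quad\text{and}\quad\langle\sigma_S(i),d_S(j)\rangle=\langle v_i,v_j\rangle\qquad\text{for all } i,j\in[n].\tag{$*$}$$ (1) If $S\in\Omega(n,k)$ is a local maximizer of $F$ on $\Omega(n,k)$, then $(*)$ holds. (2) The system $(*)$ is the complete first-order condition: a tight frame $S\in\Omega(n,k)$ is a stationary point of $F$ on $\Omega(n,k)$, that is, $F(S')=F(S)+o(\operatorname{dist}(S,S'))$ as $S'\to S$ within $\Omega(n,k)$, if and only if the vectors of $S$ are in general position (every $k$ of them with distinct indices are linearly independent) and $(*)$ holds. -/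

import Mathlib

open scoped Pointwise RealInnerProductSpace

noncomputable section

/-- An ordered family `S = (v₁, …, vₙ)` of vectors of `ℝᵏ` is a tight frame if
`∑ vᵢ ⊗ vᵢ` is the identity of `ℝᵏ`. -/
def IsTightFrame {n k : ℕ} (v : Fin n → EuclideanSpace ℝ (Fin k)) : Prop :=
  ∑ i, InnerProductSpace.rankOne ℝ (v i) (v i) =
    ContinuousLinearMap.id ℝ (EuclideanSpace ℝ (Fin k))

/-- `Ω(n, k)`: the set of all tight frames of `n` vectors in `ℝᵏ`. -/
def tightFrames (n k : ℕ) : Set (Fin n → EuclideanSpace ℝ (Fin k)) :=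
  {v | IsTightFrame v}

/-- The zonotope `[0, v₁] + ⋯ + [0, vₙ]` (Minkowski sum). -/
def zonotope {n k : ℕ} (v : Fin n → EuclideanSpace ℝ (Fin k)) :
    Set (EuclideanSpace ℝ (Fin k)) :=
  ∑ i, segment ℝ 0 (v i)

/-- `F(S)`, the `k`-dimensional volume of the zonotope of `S`. -/
def zonotopeVolume {n k : ℕ} (v : Fin n → EuclideanSpace ℝ (Fin k)) : ℝ :=
  MeasureTheory.volume.real (zonotope v)

/-- The determinant of `k` vectors of `ℝᵏ`. -/
def vecDet {k : ℕ} (w : Fin k → EuclideanSpace ℝ (Fin k)) : ℝ :=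
  Matrix.det (Matrix.of fun a b => w b a)

/-- The vectors of `S` are in general position: `det (v_{l₁}, …, v_{lₖ}) ≠ 0` for every
`k`-element set `L = {l₁ < ⋯ < lₖ}` of indices. -/
def InGeneralPosition {n k : ℕ} (v : Fin n → EuclideanSpace ℝ (Fin k)) : Prop :=
  ∀ L : Set.powersetCard (Fin n) k, vecDet (v ∘ Set.powersetCard.ofFinEmbEquiv.symm L) ≠ 0

/-- `d_S({i, L}) = det (vᵢ, v_{l₁}, …, v_{lₘ})` for `L = {l₁ < ⋯ < lₘ}`, where the dimension
is `k = m + 1`. -/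
def frameDet {n m : ℕ} (v : Fin n → EuclideanSpace ℝ (Fin (m + 1))) (i : Fin n)
    (L : Set.powersetCard (Fin n) m) : ℝ :=
  vecDet (Fin.cons (v i) (v ∘ Set.powersetCard.ofFinEmbEquiv.symm L))

/-- The standard orthonormal basis `e_L = e_{l₁} ∧ ⋯ ∧ e_{lₘ}` of `Λᵐ(ℝⁿ)`. -/
def stdExtBasis (n m : ℕ) :
    OrthonormalBasis (Set.powersetCard (Fin n) m) ℝ (⋀[ℝ]^m (EuclideanSpace ℝ (Fin n))) :=
  (EuclideanSpace.basisFun (Fin n) ℝ).exteriorPower m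

/-- `d_S(i) ∈ Λ^{k-1}(ℝⁿ)`: the `L`-th coordinate is `d_S({i, L})`. -/
def dVec {n m : ℕ} (v : Fin n → EuclideanSpace ℝ (Fin (m + 1))) (i : Fin n) :
    ⋀[ℝ]^m (EuclideanSpace ℝ (Fin n)) :=
  ∑ L, frameDet v i L • stdExtBasis n m L

/-- `σ_S(i) ∈ Λ^{k-1}(ℝⁿ)`: the `L`-th coordinate is `1 / F(S)`, `-1 / F(S)` or `0` according
to whether `d_S({i, L})` is positive, negative or zero. -/
def sigmaVec {n m : ℕ} (v : Fin n → EuclideanSpace ℝ (Fin (m + 1))) (i : Fin n) :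
    ⋀[ℝ]^m (EuclideanSpace ℝ (Fin n)) :=
  ∑ L, (Real.sign (frameDet v i L) / zonotopeVolume v) • stdExtBasis n m L

/-- `H^S ⊆ ℝⁿ`: the linear hull of the rows of the `k × n` matrix `(v₁, …, vₙ)`. -/
def rowSpace {n k : ℕ} (v : Fin n → EuclideanSpace ℝ (Fin k)) :
    Submodule ℝ (EuclideanSpace ℝ (Fin n)) :=
  Submodule.span ℝ (Set.range fun a : Fin k => WithLp.toLp 2 fun i : Fin n => v i a)

/-- `P^S`: the orthogonal projection of `ℝⁿ` onto `H^S`. -/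
def rowProj {n k : ℕ} (v : Fin n → EuclideanSpace ℝ (Fin k)) :
    EuclideanSpace ℝ (Fin n) →ₗ[ℝ] EuclideanSpace ℝ (Fin n) :=
  (rowSpace v).starProjection.toLinearMap

/-- The system `∧^{k-1} P^S (σ_S(i)) = d_S(i)` and `⟨σ_S(i), d_S(j)⟩ = ⟨vᵢ, vⱼ⟩`
for all `i`, `j`. -/
def SigmaSystem {n m : ℕ} (v : Fin n → EuclideanSpace ℝ (Fin (m + 1))) : Prop :=
  (∀ i, exteriorPower.map m (rowProj v) (sigmaVec v i) = dVec v i) ∧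
    ∀ i j, ⟪sigmaVec v i, dVec v j⟫ = ⟪v i, v j⟫

end

open scoped Pointwise RealInnerProductSpace
open MeasureTheory Filter Topology

noncomputable section

/-! The zonotope volume is the sum of the absolute values of the `k × k` minors, so `k! F` is the
sum of `|det (v ∘ f)|` over all `f : Fin k → Fin n`. Rotating two members `v i`, `v j` into each
other stays inside the tight frames, and first-order maximality along these curves suffices for the
forward directions. A sum of absolute values has only convex kinks at vanishing minors; bounding the
right derivative in both time directions forces each vanishing minor to have zero velocity and the
signed sum of velocities to vanish.

Zero velocity is an exchange rule: a vanishing minor still vanishes after one index is swapped for a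
new one. Exchanges that raise the rank then contradict spanning, which gives general position. The
signed sum says that the forms `signForm v i` satisfy ℓ_i(v_j) = ℓ_j(v_i). Cramer's rule gives ∑
ℓ_i(x)⟨v_i, y⟩ = m! F ⟨x, y⟩, and with the frame expansion the two yield ℓ_i = m! F ⟨v_i, ·⟩, the
second equation of the system. The first follows because the exterior power of the projection is ∑
d(j) ⊗ d(j).

Conversely, in general position `F` is differentiable, and its gradient is that of (F(v)/2) ∑
|w_i|², a function constant on tight frames. -/

/-! ### Zonotope volume as a sum of minors. -/

theorem image_segment_zero {E E' : Type*} [AddCommGroup E] [Module ℝ E] [AddCommGroup E']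
    [Module ℝ E'] (A : E →ₗ[ℝ] E') (x : E) :
    A '' segment ℝ 0 x = segment ℝ 0 (A x) := by
  have := image_segment ℝ A.toAffineMap 0 x
  simpa using this

theorem volume_add_Icc_of_convex_of_isCompact {K : Set ℝ} (hK : IsCompact K) (hc : Convex ℝ K)
    (hne : K.Nonempty) : volume (K + Set.Icc (0 : ℝ) 1) = volume K + 1 := by
  have h := eq_Icc_of_connected_compact ⟨hne, hc.isPreconnected⟩ hK
  set a := sInf K
  set b := sSup K
  have hab : a ≤ b := by
    rw [h] at hne
    exact Set.nonempty_Icc.1 hne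
  rw [h, Set.Icc_add_Icc hab zero_le_one, Real.volume_Icc, Real.volume_Icc,
    ← ENNReal.ofReal_one, ← ENNReal.ofReal_add (by linarith) zero_le_one]
  congr 1
  ring

/-- Adding a unit segment in the first direction to a convex body increases its volume by the
volume of its projection along that direction. -/
theorem prod_volume_add_segment {G : Type*} [NormedAddCommGroup G] [NormedSpace ℝ G]
    [MeasurableSpace G] [BorelSpace G] [SecondCountableTopology G] (ν : Measure G) [SFinite ν]
    {K : Set (ℝ × G)} (hK : IsCompact K) (hc : Convex ℝ K) :
    (volume.prod ν) (K + segment ℝ 0 ((1 : ℝ), (0 : G))) =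
      (volume.prod ν) K + ν (Prod.snd '' K) := by
  have hseg : segment ℝ 0 ((1 : ℝ), (0 : G)) = (fun x : ℝ => (x, (0 : G))) '' Set.Icc 0 1 := by
    rw [segment_eq_image]
    simp
  have hsegc : IsCompact (segment ℝ 0 ((1 : ℝ), (0 : G))) := by
    rw [hseg]
    exact isCompact_Icc.image (by fun_prop)
  have hsnd : MeasurableSet (Prod.snd '' K) := (hK.image continuous_snd).measurableSet
  -- Fubini over the second coordinate: each nonempty fibre is a compact interval and grows by
  -- exactly 1, so the gain is the measure of the projection.
  rw [Measure.prod_apply_symm (hK.add hsegc).measurableSet, Measure.prod_apply_symm hK.measurableSet,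
    ← lintegral_indicator_one hsnd, ← lintegral_add_right _ (measurable_one.indicator hsnd)]
  refine lintegral_congr fun y => ?_
  have hfib : (fun x => (x, y)) ⁻¹' (K + segment ℝ 0 ((1 : ℝ), (0 : G))) =
      (fun x => (x, y)) ⁻¹' K + Set.Icc (0 : ℝ) 1 := by
    ext x
    rw [hseg]
    simp only [Set.mem_preimage, Set.mem_add, Set.mem_image]
    constructor
    · rintro ⟨⟨p, q⟩, hp, _, ⟨t, ht, rfl⟩, h⟩
      simp only [Prod.mk_add_mk, add_zero, Prod.mk.injEq] at h
      exact ⟨p, h.2 ▸ hp, t, ht, h.1⟩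
    · rintro ⟨p, hp, t, ht, rfl⟩
      exact ⟨_, hp, _, ⟨t, ht, rfl⟩, by simp⟩
  rw [hfib]
  by_cases hy : y ∈ Prod.snd '' K
  · rw [Set.indicator_of_mem hy]
    refine volume_add_Icc_of_convex_of_isCompact ?_ ?_ ?_
    · have : (fun x => (x, y)) ⁻¹' K = Prod.fst '' (K ∩ Prod.snd ⁻¹' {y}) := by
        ext x
        simp
      rw [this]
      exact (hK.inter_right (isClosed_singleton.preimage continuous_snd)).image continuous_fst
    · intro p hp q hq a b ha hb hab
      have := hc hp hq ha hb hab
      simpa [← add_smul, hab] using this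
    · obtain ⟨⟨p, q⟩, hp, rfl⟩ := hy
      exact ⟨p, hp⟩
  · have : (fun x => (x, y)) ⁻¹' K = ∅ := by
      ext x
      simp only [Set.mem_preimage, Set.mem_empty_iff_false, iff_false]
      exact fun h => hy ⟨_, h, rfl⟩
    rw [Set.indicator_of_notMem hy, this]
    simp

theorem volume_add_segment_single {k : ℕ} {K : Set (Fin (k + 1) → ℝ)} (hK : IsCompact K)
    (hc : Convex ℝ K) :
    volume (K + segment ℝ 0 (Pi.single 0 1)) =
      volume K + volume (LinearMap.funLeft ℝ ℝ Fin.succ '' K) := by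
  have hmp := volume_preserving_piFinSuccAbove (fun _ : Fin (k + 1) => ℝ) 0
  let e : (Fin (k + 1) → ℝ) →ₗ[ℝ] ℝ × (Fin k → ℝ) :=
    (LinearMap.proj 0).prod (LinearMap.funLeft ℝ ℝ Fin.succ)
  have he : ⇑e = MeasurableEquiv.piFinSuccAbove (fun _ : Fin (k + 1) => ℝ) 0 := by
    ext x <;> rfl
  have hvol : ∀ A : Set (Fin (k + 1) → ℝ), volume A = (volume.prod volume) (e '' A) := by
    intro A
    rw [he, MeasurableEquiv.image_eq_preimage_symm]
    exact (hmp.symm.measure_preimage_equiv A).symm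
  have hec : Continuous e := e.continuous_of_finiteDimensional
  rw [hvol, hvol K, Set.image_add e, image_segment_zero]
  have h0 : e (Pi.single 0 1) = (1, 0) := by
    ext <;> simp [e, LinearMap.funLeft]
  have := prod_volume_add_segment (volume : Measure (Fin k → ℝ)) (hK.image hec)
    (hc.linear_image e)
  rw [h0, this, Set.image_image]
  rfl

/-- The absolute value of the determinant of the vectors of a family indexed by a finite set with
as many elements as the dimension. -/
def absDet {n k : ℕ} (v : Fin n → Fin k → ℝ) (s : Finset (Fin n)) : ℝ :=
  if h : s.card = k then |Matrix.det (Matrix.of fun b => v (s.orderEmbOfFin h b))| else 0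

theorem absDet_nonneg {n k : ℕ} (v : Fin n → Fin k → ℝ) (s : Finset (Fin n)) :
    0 ≤ absDet v s := by
  unfold absDet
  split_ifs
  · positivity
  · rfl

/-- Reordering the rows only changes the sign of the determinant. -/
theorem absDet_eq_of_injective {n k : ℕ} (v : Fin n → Fin k → ℝ) {s : Finset (Fin n)}
    (hs : s.card = k) {f : Fin k → Fin n} (hf : Function.Injective f) (hfs : ∀ b, f b ∈ s) :
    absDet v s = |Matrix.det (Matrix.of fun b => v (f b))| := by
  let σ : Fin k → Fin k := fun b => (s.orderIsoOfFin hs).symm ⟨f b, hfs b⟩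
  have hσ : Function.Bijective σ := by
    rw [Finite.injective_iff_bijective.symm]
    intro a b hab
    exact hf (by simpa [σ] using hab)
  have hfσ : ∀ b, f b = s.orderEmbOfFin hs (σ b) := by
    intro b
    simp [σ, ← Finset.coe_orderIsoOfFin_apply]
  have : (Matrix.of fun b => v (f b)) =
      (Matrix.of fun b => v (s.orderEmbOfFin hs b)).submatrix (Equiv.ofBijective σ hσ) id := by
    ext b c
    simp [hfσ]
  rw [this, Matrix.det_permute, abs_mul, absDet, dif_pos hs]
  rcases Int.units_eq_one_or (Equiv.Perm.sign (Equiv.ofBijective σ hσ)) with h | h <;> simp [h]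

theorem absDet_linear_image {n k : ℕ} (A : (Fin k → ℝ) →ₗ[ℝ] (Fin k → ℝ))
    (v : Fin n → Fin k → ℝ) (s : Finset (Fin n)) :
    absDet (fun i => A (v i)) s = |LinearMap.det A| * absDet v s := by
  unfold absDet
  split_ifs with h
  · rw [← abs_mul]
    congr 1
    rw [← LinearMap.det_toMatrix', ← Matrix.det_transpose (LinearMap.toMatrix' A), mul_comm,
      ← Matrix.det_mul]
    congr 1
    ext b c
    simp only [Matrix.of_apply, Matrix.mul_apply, Matrix.transpose_apply]
    rw [← LinearMap.toMatrix'_mulVec A]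
    simp [Matrix.mulVec, dotProduct, mul_comm]
  · simp

/-- Laplace expansion along the row `Pi.single 0 1` leaves one minor, that of the vectors projected
along the first axis. -/
theorem absDet_insert_of_eq_single {n k : ℕ} (v : Fin n → Fin (k + 1) → ℝ) {a : Fin n}
    (ha : v a = Pi.single 0 1) {s : Finset (Fin n)} (hs : s.card = k) (has : a ∉ s) :
    absDet v (insert a s) = absDet (fun i => LinearMap.funLeft ℝ ℝ Fin.succ (v i)) s := by
  have hf : Function.Injective (Fin.cons a (s.orderEmbOfFin hs) : Fin (k + 1) → Fin n) := by
    rw [Fin.cons_injective_iff]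
    refine ⟨?_, (s.orderEmbOfFin hs).injective⟩
    rintro ⟨b, rfl⟩
    exact has (s.orderEmbOfFin_mem hs b)
  rw [absDet_eq_of_injective v (by rw [Finset.card_insert_of_notMem has, hs]) hf, absDet,
    dif_pos hs, Matrix.det_succ_row_zero, Finset.sum_eq_single 0]
  · simp [ha]
    rfl
  · intro b _ hb
    simp [ha, hb]
  · simp
  · refine Fin.cases ?_ fun b => ?_
    · simp
    · simp

theorem absDet_insert_of_eq_zero {n k : ℕ} (v : Fin n → Fin k → ℝ) {a : Fin n}
    (ha : v a = 0) (s : Finset (Fin n)) : absDet v (insert a s) = 0 := by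
  unfold absDet
  split_ifs with h
  · rw [abs_eq_zero]
    have : a ∈ Set.range ((insert a s).orderEmbOfFin h) := by simp
    obtain ⟨b, hb⟩ := this
    refine Matrix.det_eq_zero_of_row_eq_zero b fun c => ?_
    simp [hb, ha]
  · rfl

theorem isCompact_sum_segment {ι E : Type*} [NormedAddCommGroup E] [NormedSpace ℝ E]
    (s : Finset ι) (v : ι → E) : IsCompact (∑ i ∈ s, segment ℝ 0 (v i)) := by
  classical
  induction s using Finset.induction_on with
  | empty => simp
  | insert a s ha ih =>
    rw [Finset.sum_insert ha]
    refine IsCompact.add ?_ ih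
    rw [segment_eq_image]
    exact isCompact_Icc.image (by fun_prop)

theorem convex_sum_segment {ι E : Type*} [NormedAddCommGroup E] [NormedSpace ℝ E]
    (s : Finset ι) (v : ι → E) : Convex ℝ (∑ i ∈ s, segment ℝ 0 (v i)) :=
  convex_sum _ fun _ _ => convex_segment _ _

theorem image_sum_segment {ι E E' : Type*} [AddCommGroup E] [Module ℝ E]
    [AddCommGroup E'] [Module ℝ E'] (A : E →ₗ[ℝ] E') (s : Finset ι) (v : ι → E) :
    A '' (∑ i ∈ s, segment ℝ 0 (v i)) = ∑ i ∈ s, segment ℝ 0 (A (v i)) := by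
  rw [Set.image_finsetSum]
  refine Finset.sum_congr rfl fun i _ => ?_
  exact image_segment_zero A _

theorem sum_powersetCard_succ_insert {ι : Type*} [DecidableEq ι] {a : ι} {s : Finset ι}
    (ha : a ∉ s) (k : ℕ) (g : Finset ι → ℝ) :
    ∑ L ∈ (insert a s).powersetCard (k + 1), g L =
      ∑ L ∈ s.powersetCard (k + 1), g L + ∑ L ∈ s.powersetCard k, g (insert a L) := by
  rw [Finset.powersetCard_succ_insert ha, Finset.sum_union, Finset.sum_image]
  · intro L hL L' hL' h
    rw [Finset.mem_coe, Finset.mem_powersetCard] at hL hL'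
    rw [← Finset.erase_insert fun h => ha (hL.1 h), h, Finset.erase_insert fun h => ha (hL'.1 h)]
  · rw [Finset.disjoint_left]
    intro L hL hL'
    obtain ⟨L', -, rfl⟩ := Finset.mem_image.1 hL'
    exact ha ((Finset.mem_powersetCard.1 hL).1 (Finset.mem_insert_self _ _))

/-- The volume of a zonotope is the sum of the absolute values of the maximal minors of its
generators. -/
theorem volume_sum_segment {n : ℕ} (s : Finset (Fin n)) :
    ∀ (k : ℕ) (v : Fin n → Fin k → ℝ), volume (∑ i ∈ s, segment ℝ 0 (v i)) =
      ENNReal.ofReal (∑ L ∈ s.powersetCard k, absDet v L) := by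
  induction s using Finset.induction_on with
  | empty =>
    intro k v
    rcases k with _ | k
    · simp [absDet, Measure.volume_pi_eq_dirac (0 : Fin 0 → ℝ)]
    · rw [Finset.powersetCard_eq_empty.2 (by simp)]
      simp [← Set.singleton_zero]
  | insert a s ha ih =>
    intro k v
    rcases k with _ | k
    · rw [Finset.powersetCard_zero, Finset.sum_singleton]
      have : (∑ i ∈ insert a s, segment ℝ 0 (v i)) = Set.univ := by
        refine Set.eq_univ_of_forall fun x => ?_
        rw [Subsingleton.elim x (∑ i ∈ insert a s, 0)]
        exact Set.finsetSum_mem_finsetSum _ _ _ fun i _ => left_mem_segment _ _ _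
      rw [this]
      simp [absDet, Measure.volume_pi_eq_dirac (0 : Fin 0 → ℝ)]
    · rw [sum_powersetCard_succ_insert ha]
      by_cases hva : v a = 0
      · rw [Finset.sum_insert ha, hva, segment_same, Set.singleton_zero, zero_add, ih]
        simp [absDet_insert_of_eq_zero v hva]
      · obtain ⟨A, hA⟩ := SeparatingDual.exists_continuousLinearEquiv_apply_eq (R := ℝ)
          (x := (Pi.single 0 1 : Fin (k + 1) → ℝ)) (y := v a) (by simp) hva
        let w : Fin n → Fin (k + 1) → ℝ := fun i => A.symm (v i)
        have hw : ∀ i, v i = (A : (Fin (k + 1) → ℝ) →ₗ[ℝ] (Fin (k + 1) → ℝ)) (w i) := by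
          intro i
          simp [w]
        have hwa : w a = Pi.single 0 1 := by simp [w, ← hA]
        clear_value w
        have hsum : ∑ L ∈ s.powersetCard k, absDet w (insert a L) =
            ∑ L ∈ s.powersetCard k, absDet (fun i => LinearMap.funLeft ℝ ℝ Fin.succ (w i)) L := by
          refine Finset.sum_congr rfl fun L hL => ?_
          rw [Finset.mem_powersetCard] at hL
          exact absDet_insert_of_eq_single w hwa hL.2 fun h => ha (hL.1 h)
        obtain rfl : v = fun i => (A : (Fin (k + 1) → ℝ) →ₗ[ℝ] (Fin (k + 1) → ℝ)) (w i) :=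
          funext hw
        simp_rw [absDet_linear_image]
        rw [← image_sum_segment, Measure.addHaar_image_linearMap, ← Finset.mul_sum,
          ← Finset.mul_sum, hsum, ← mul_add, ENNReal.ofReal_mul (abs_nonneg _),
          ENNReal.ofReal_add (Finset.sum_nonneg fun _ _ => absDet_nonneg _ _)
            (Finset.sum_nonneg fun _ _ => absDet_nonneg _ _), ← ih, ← ih, Finset.sum_insert ha,
          add_comm (segment ℝ 0 (w a)), hwa,
          volume_add_segment_single (isCompact_sum_segment _ _) (convex_sum_segment _ _),
          image_sum_segment]

/-! ### The determinant form and sums over index functions. -/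

/-- The determinant as a continuous alternating form on `ℝᵏ`. -/
def vecDetForm (k : ℕ) : EuclideanSpace ℝ (Fin k) [⋀^Fin k]→L[ℝ] ℝ :=
  { toAlternatingMap := Matrix.detRowAlternating.compLinearMap
      (WithLp.linearEquiv 2 ℝ (Fin k → ℝ)).toLinearMap
    cont := by
      refine Continuous.matrix_det (A := fun w : Fin k → EuclideanSpace ℝ (Fin k) =>
        Matrix.of fun a b => w a b) ?_
      refine continuous_matrix fun a b => ?_
      simp only [Matrix.of_apply]
      fun_prop }

theorem vecDetForm_apply {k : ℕ} (w : Fin k → EuclideanSpace ℝ (Fin k)) :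
    vecDetForm k w = Matrix.det (Matrix.of fun a b => w a b) := rfl

theorem vecDet_eq_vecDetForm {k : ℕ} (w : Fin k → EuclideanSpace ℝ (Fin k)) :
    vecDet w = vecDetForm k w := by
  rw [vecDetForm_apply, vecDet, ← Matrix.det_transpose]
  rfl

theorem vecDetForm_comp_eq_zero {k n : ℕ} (v : Fin n → EuclideanSpace ℝ (Fin k))
    {f : Fin k → Fin n} (hf : ¬ Function.Injective f) : vecDetForm k (v ∘ f) = 0 := by
  refine (vecDetForm k).toAlternatingMap.map_eq_zero_of_not_injective _ fun h => hf ?_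
  exact h.of_comp

/-- A sum over all functions `Fin m → Fin n` of a symmetric function which vanishes at the
functions that are not injective is a sum over the `m`-element subsets. -/
theorem sum_fun_eq_factorial_mul_sum_powersetCard {n m : ℕ} (q : (Fin m → Fin n) → ℝ)
    (h0 : ∀ f, ¬ Function.Injective f → q f = 0)
    (hq : ∀ f (σ : Equiv.Perm (Fin m)), q (f ∘ σ) = q f) :
    ∑ f, q f = m.factorial *
      ∑ L : Set.powersetCard (Fin n) m, q (Set.powersetCard.ofFinEmbEquiv.symm L) := by
  have h1 : ∑ f, q f = ∑ p : Set.powersetCard (Fin n) m × Equiv.Perm (Fin m),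
      q (Set.powersetCard.ofFinEmbEquiv.symm p.1 ∘ p.2) := by
    symm
    -- Each injective function is uniquely an increasing enumeration of its range composed with a
    -- permutation.
    refine Finset.sum_of_injOn (fun p => Set.powersetCard.ofFinEmbEquiv.symm p.1 ∘ p.2) ?_
      (by simp) ?_ (by simp)
    · rintro ⟨L, σ⟩ - ⟨L', σ'⟩ - h
      simp only at h
      have hL : L = L' := by
        ext i
        have := congrArg (fun g => i ∈ Set.range g) h
        simp only [EquivLike.range_comp, eq_iff_iff] at this
        simp only [Set.powersetCard.mem_range_ofFinEmbEquiv_symm_iff_mem] at this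
        exact this
      subst hL
      congr 1
      ext1 a
      exact (Set.powersetCard.ofFinEmbEquiv.symm L).injective (congrFun h a)
    · intro f _ hf
      refine h0 f fun hinj => hf ?_
      let L : Set.powersetCard (Fin n) m := Set.powersetCard.ofFinEmb m (Fin n) ⟨f, hinj⟩
      have hmem : ∀ a, ∃ b, Set.powersetCard.ofFinEmbEquiv.symm L b = f a := by
        intro a
        have : f a ∈ Set.range (Set.powersetCard.ofFinEmbEquiv.symm L) := by
          rw [Set.powersetCard.mem_range_ofFinEmbEquiv_symm_iff_mem]
          simp [L]
        exact this
      choose σ hσ using hmem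
      have hσb : Function.Bijective σ := by
        rw [← Finite.injective_iff_bijective]
        intro a b hab
        refine hinj ?_
        rw [← hσ, ← hσ, hab]
      exact ⟨(L, Equiv.ofBijective σ hσb), by simp, funext hσ⟩
  rw [h1, Fintype.sum_prod_type, Finset.mul_sum]
  refine Finset.sum_congr rfl fun L _ => ?_
  simp [hq, Fintype.card_perm]

/-- The zonotope volume as a sum over all families of `k` indices. -/
theorem factorial_mul_zonotopeVolume {n k : ℕ} (v : Fin n → EuclideanSpace ℝ (Fin k)) :
    k.factorial * zonotopeVolume v = ∑ f : Fin k → Fin n, |vecDetForm k (v ∘ f)| := by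
  rw [sum_fun_eq_factorial_mul_sum_powersetCard]
  · congr 1
    have h := volume_sum_segment Finset.univ k fun i => (v i).ofLp
    have himg : WithLp.ofLp '' zonotope v = ∑ i, segment ℝ 0 (v i).ofLp :=
      image_sum_segment (WithLp.linearEquiv 2 ℝ (Fin k → ℝ)).toLinearMap _ v
    have hvol : volume (zonotope v) = volume (WithLp.ofLp '' zonotope v) := by
      have := (PiLp.volume_preserving_toLp (Fin k)).measure_preimage_equiv
        (f := MeasurableEquiv.toLp 2 (Fin k → ℝ)) (zonotope v)
      rw [← this]
      congr 1
      ext x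
      constructor
      · intro hx
        exact ⟨_, hx, rfl⟩
      · rintro ⟨y, hy, rfl⟩
        exact hy
    rw [zonotopeVolume, Measure.real, hvol, himg, h,
      ENNReal.toReal_ofReal (Finset.sum_nonneg fun _ _ => absDet_nonneg _ _)]
    symm
    refine Finset.sum_bij (fun L _ => L.1) ?_ ?_ ?_ ?_
    · intro L _
      exact Finset.mem_powersetCard.2 ⟨Finset.subset_univ _, L.2⟩
    · intro L _ L' _ h
      exact Subtype.ext h
    · intro L hL
      exact ⟨⟨L, (Finset.mem_powersetCard.1 hL).2⟩, Finset.mem_univ _, rfl⟩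
    · intro L _
      rw [absDet, dif_pos (show L.1.card = k from L.2)]
      rfl
  · intro f hf
    rw [vecDetForm_comp_eq_zero v hf, abs_zero]
  · intro f σ
    rw [← Function.comp_assoc]
    have := (vecDetForm k).toAlternatingMap.map_perm (v ∘ f) σ
    simp only [ContinuousAlternatingMap.coe_toAlternatingMap] at this
    rw [this]
    rcases Int.units_eq_one_or (Equiv.Perm.sign σ) with h | h <;> simp [h]

/-! ### First-order conditions for sums of absolute values. -/

/-- At a zero of `h`, the right slopes of `|h|` are the absolute values of those of `h`. -/
theorem hasDerivWithinAt_abs_Ioi {h : ℝ → ℝ} {b : ℝ} (hd : HasDerivAt h b 0) :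
    HasDerivWithinAt (fun t => |h t|) (if h 0 = 0 then |b| else Real.sign (h 0) * b)
      (Set.Ioi 0) 0 := by
  split_ifs with h0
  · rw [hasDerivWithinAt_iff_tendsto_slope' (by simp)]
    have := ((hasDerivWithinAt_iff_tendsto_slope' (by simp)).1
      (hd.hasDerivWithinAt (s := Set.Ioi 0))).abs
    refine this.congr' ?_
    filter_upwards [self_mem_nhdsWithin] with t ht
    simp only [slope_def_field, h0, sub_zero, abs_zero, abs_div, abs_of_pos (Set.mem_Ioi.1 ht)]
  · rcases lt_or_gt_of_ne h0 with h1 | h1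
    · rw [Real.sign_of_neg h1]
      exact ((hasDerivAt_abs_neg h1).comp 0 hd).hasDerivWithinAt
    · rw [Real.sign_of_pos h1]
      exact ((hasDerivAt_abs_pos h1).comp 0 hd).hasDerivWithinAt

theorem sum_right_deriv_abs_nonpos {ι : Type*} [Fintype ι] {h : ι → ℝ → ℝ} {b : ι → ℝ}
    (hd : ∀ f, HasDerivAt (h f) (b f) 0)
    (hle : ∀ ε > 0, ∀ᶠ t in 𝓝 (0 : ℝ), ∑ f, |h f t| ≤ ∑ f, |h f 0| + ε * |t|) :
    ∑ f, (if h f 0 = 0 then |b f| else Real.sign (h f 0) * b f) ≤ 0 := by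
  have hs : HasDerivWithinAt (fun t => ∑ f, |h f t|) _ (Set.Ioi 0) 0 :=
    HasDerivWithinAt.fun_sum (u := Finset.univ) fun f _ => hasDerivWithinAt_abs_Ioi (hd f)
  rw [hasDerivWithinAt_iff_tendsto_slope' (by simp)] at hs
  refine le_of_forall_pos_le_add fun ε hε => ?_
  rw [zero_add]
  refine le_of_tendsto hs ?_
  filter_upwards [self_mem_nhdsWithin, (hle ε hε).filter_mono nhdsWithin_le_nhds] with t ht h1
  rw [abs_of_pos (Set.mem_Ioi.1 ht)] at h1
  rw [slope_def_field, sub_zero, div_le_iff₀ (Set.mem_Ioi.1 ht)]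
  linarith

/-- First-order condition for a sum of absolute values of differentiable functions. -/
theorem sum_abs_first_order {ι : Type*} [Fintype ι] {h : ι → ℝ → ℝ} {b : ι → ℝ}
    (hd : ∀ f, HasDerivAt (h f) (b f) 0)
    (hle : ∀ ε > 0, ∀ᶠ t in 𝓝 (0 : ℝ), ∑ f, |h f t| ≤ ∑ f, |h f 0| + ε * |t|) :
    (∀ f, h f 0 = 0 → b f = 0) ∧ ∑ f, Real.sign (h f 0) * b f = 0 := by
  have hr := sum_right_deriv_abs_nonpos hd hle
  have hl := sum_right_deriv_abs_nonpos (h := fun f t => h f (-t)) (b := fun f => -b f)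
    (fun f => by
      have h1 : HasDerivAt (h f) (b f) (-0) := by simpa using hd f
      simpa [Function.comp_def] using h1.comp (0 : ℝ) (hasDerivAt_neg (0 : ℝ)))
    (fun ε hε => by
      have h1 : Tendsto (fun t : ℝ => -t) (𝓝 0) (𝓝 0) := by
        simpa using (continuous_neg (G := ℝ)).tendsto 0
      simpa using h1.eventually (hle ε hε))
  simp only [neg_zero, abs_neg] at hl
  -- Under time reversal the kink terms are even and the signed terms odd. Adding the two
  -- inequalities makes the nonnegative kink sum zero; the signed sum is then both `≤ 0` and `≥ 0`.
  have e1 : ∀ f, (if h f 0 = 0 then |b f| else Real.sign (h f 0) * b f) =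
      (if h f 0 = 0 then |b f| else 0) + Real.sign (h f 0) * b f := by
    intro f
    split_ifs with h0 <;> simp [h0]
  have e2 : ∀ f, (if h f 0 = 0 then |b f| else Real.sign (h f 0) * -b f) =
      (if h f 0 = 0 then |b f| else 0) - Real.sign (h f 0) * b f := by
    intro f
    split_ifs with h0 <;> simp [h0]
  simp only [e1, Finset.sum_add_distrib] at hr
  simp only [e2, Finset.sum_sub_distrib] at hl
  have hnn : ∀ f ∈ Finset.univ, 0 ≤ (if h f 0 = 0 then |b f| else 0) := by
    intro f _
    split_ifs <;> positivity
  have h0 := Finset.sum_nonneg hnn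
  refine ⟨fun f hf => ?_, by linarith⟩
  have := (Finset.sum_eq_zero_iff_of_nonneg hnn).1 (by linarith) f (Finset.mem_univ f)
  simpa [hf] using this

/-! ### Rotations of tight frames. -/

section

variable {n k : ℕ}

theorem isTightFrame_iff (v : Fin n → EuclideanSpace ℝ (Fin k)) :
    IsTightFrame v ↔ ∀ x, ∑ i, ⟪v i, x⟫ • v i = x := by
  rw [IsTightFrame, ContinuousLinearMap.ext_iff]
  simp

/-- Rotation by the angle `t` in the plane of the coordinates `i` and `j`, applied to a family
of vectors. -/
def givens (v : Fin n → EuclideanSpace ℝ (Fin k)) (i j : Fin n) (t : ℝ) (l : Fin n) :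
    EuclideanSpace ℝ (Fin k) :=
  if l = i then Real.cos t • v i + Real.sin t • v j
  else if l = j then Real.cos t • v j - Real.sin t • v i
  else v l

/-- The initial velocity of `givens`. -/
def givensVelocity (v : Fin n → EuclideanSpace ℝ (Fin k)) (i j l : Fin n) :
    EuclideanSpace ℝ (Fin k) :=
  if l = i then v j else if l = j then -v i else 0

theorem givens_zero (v : Fin n → EuclideanSpace ℝ (Fin k)) (i j : Fin n) : givens v i j 0 = v := by
  ext1 l
  unfold givens
  split_ifs with h1 h2 <;> simp [*]

/-- In the sum of `v l ⊗ v l` the cross terms cancel and cos² + sin² = 1 restores the squares. -/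
theorem IsTightFrame.givens {v : Fin n → EuclideanSpace ℝ (Fin k)} (hv : IsTightFrame v)
    {i j : Fin n} (hij : i ≠ j) (t : ℝ) : IsTightFrame (givens v i j t) := by
  rw [isTightFrame_iff] at hv ⊢
  intro x
  rw [← sub_eq_zero]
  conv_lhs => rhs; rw [← hv x]
  rw [← Finset.sum_sub_distrib, Fintype.sum_eq_add i j hij]
  · have hsc := Real.sin_sq_add_cos_sq t
    simp only [_root_.givens, if_true, if_neg hij.symm, inner_add_left, inner_sub_left,
      real_inner_smul_left]
    have hc : Real.cos t ^ 2 = 1 - Real.sin t ^ 2 := by linarith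
    match_scalars
    · linear_combination ⟪v i, x⟫ * hsc
    · linear_combination ⟪v j, x⟫ * hsc
  · rintro l ⟨h1, h2⟩
    simp [_root_.givens, h1, h2]

theorem hasDerivAt_givens (v : Fin n → EuclideanSpace ℝ (Fin k)) (i j : Fin n) :
    HasDerivAt (givens v i j) (givensVelocity v i j) 0 := by
  rw [hasDerivAt_pi]
  intro l
  unfold givens givensVelocity
  have hc := Real.hasDerivAt_cos 0
  have hs := Real.hasDerivAt_sin 0
  split_ifs with h1 h2
  · simpa using (hc.smul_const (v i)).fun_add (hs.smul_const (v j))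
  · simpa using (hc.smul_const (v j)).fun_sub (hs.smul_const (v i))
  · exact hasDerivAt_const _ _

theorem hasFDerivAt_vecDetForm_comp (v : Fin n → EuclideanSpace ℝ (Fin k)) (f : Fin k → Fin n) :
    HasFDerivAt (fun w : Fin n → EuclideanSpace ℝ (Fin k) => vecDetForm k (w ∘ f))
      (((vecDetForm k).toContinuousMultilinearMap.linearDeriv (v ∘ f)).comp
        (ContinuousLinearMap.pi fun p => ContinuousLinearMap.proj (f p))) v :=
  ((vecDetForm k).toContinuousMultilinearMap.hasFDerivAt (v ∘ f)).comp v
    (ContinuousLinearMap.pi fun p => ContinuousLinearMap.proj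
      (φ := fun _ : Fin n => EuclideanSpace ℝ (Fin k)) (R := ℝ) (f p)).hasFDerivAt

theorem hasDerivAt_vecDetForm_givens (v : Fin n → EuclideanSpace ℝ (Fin k)) (i j : Fin n)
    (f : Fin k → Fin n) :
    HasDerivAt (fun t => vecDetForm k (givens v i j t ∘ f))
      (∑ p, vecDetForm k (Function.update (v ∘ f) p (givensVelocity v i j (f p)))) 0 := by
  have h := hasFDerivAt_vecDetForm_comp (givens v i j 0) f
  have := h.comp_hasDerivAt 0 (hasDerivAt_givens v i j)
  rw [givens_zero] at this
  simpa [Function.comp_def] using this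

/-- First-order maximality along rotations, which holds for local maximizers and for stationary
points. -/
def IsRotationMax (v : Fin n → EuclideanSpace ℝ (Fin k)) : Prop :=
  ∀ i j, i ≠ j → ∀ ε > 0, ∀ᶠ t in 𝓝 (0 : ℝ),
    zonotopeVolume (givens v i j t) ≤ zonotopeVolume v + ε * |t|

theorem IsTightFrame.isRotationMax_of_isLocalMaxOn {v : Fin n → EuclideanSpace ℝ (Fin k)}
    (hv : IsTightFrame v) (h : IsLocalMaxOn zonotopeVolume (tightFrames n k) v) :
    IsRotationMax v := by
  intro i j hij ε hε
  have hc : Tendsto (_root_.givens v i j) (𝓝 0) (𝓝[tightFrames n k] v) := by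
    refine tendsto_nhdsWithin_iff.2 ⟨?_, Eventually.of_forall fun t => hv.givens hij t⟩
    simpa [givens_zero] using (hasDerivAt_givens v i j).continuousAt.tendsto
  filter_upwards [hc.eventually h] with t ht
  have : 0 ≤ ε * |t| := by positivity
  linarith

theorem IsTightFrame.isRotationMax_of_hasFDerivWithinAt {v : Fin n → EuclideanSpace ℝ (Fin k)}
    (hv : IsTightFrame v) (h : HasFDerivWithinAt zonotopeVolume
      (0 : (Fin n → EuclideanSpace ℝ (Fin k)) →L[ℝ] ℝ) (tightFrames n k) v) :
    IsRotationMax v := by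
  intro i j hij ε hε
  rw [← givens_zero v i j] at h
  have h1 := h.comp_hasDerivAt (0 : ℝ) (hasDerivAt_givens v i j)
    (Eventually.of_forall fun t => hv.givens hij t)
  have h2 := (hasDerivAt_iff_isLittleO.1 h1).def hε
  filter_upwards [h2] with t ht
  simp only [Function.comp_apply, givens_zero, zero_apply, smul_zero,
    sub_zero, Real.norm_eq_abs] at ht
  linarith [le_abs_self (zonotopeVolume (_root_.givens v i j t) - zonotopeVolume v)]

theorem IsRotationMax.first_order {v : Fin n → EuclideanSpace ℝ (Fin k)} (h : IsRotationMax v)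
    {i j : Fin n} (hij : i ≠ j) :
    (∀ f : Fin k → Fin n, vecDetForm k (v ∘ f) = 0 →
      ∑ p, vecDetForm k (Function.update (v ∘ f) p (givensVelocity v i j (f p))) = 0) ∧
    ∑ f : Fin k → Fin n, Real.sign (vecDetForm k (v ∘ f)) *
      ∑ p, vecDetForm k (Function.update (v ∘ f) p (givensVelocity v i j (f p))) = 0 := by
  have := sum_abs_first_order (hasDerivAt_vecDetForm_givens v i j) (fun ε hε => ?_)
  · simpa only [givens_zero] using this
  have hk : (0 : ℝ) < k.factorial := by positivity
  filter_upwards [h i j hij (ε / k.factorial) (by positivity)] with t ht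
  rw [givens_zero, ← factorial_mul_zonotopeVolume, ← factorial_mul_zonotopeVolume]
  calc _ ≤ (k.factorial : ℝ) * (zonotopeVolume v + ε / k.factorial * |t|) := by gcongr
    _ = _ := by field_simp

end

/-! ### The sign forms and their symmetry. -/

/-- Swapping positions `0` and `p` permutes the index functions, so every position contributes as
much as position `0`. -/
theorem sum_fun_sum_eq_of_swap {n m : ℕ} (h : (Fin (m + 1) → Fin n) → Fin (m + 1) → ℝ)
    (hh : ∀ f p, h (f ∘ Equiv.swap 0 p) 0 = h f p) :
    ∑ f, ∑ p, h f p = (m + 1) * ∑ i, ∑ g, h (Fin.cons i g) 0 := by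
  have h1 : ∀ p, ∑ f, h f p = ∑ f, h f 0 := by
    intro p
    simp_rw [← hh _ p]
    exact Equiv.sum_comp ((Equiv.swap 0 p).arrowCongr (Equiv.refl (Fin n))) fun f => h f 0
  have h2 : ∑ f, h f 0 = ∑ i, ∑ g, h (Fin.cons i g) 0 := by
    rw [← Equiv.sum_comp (Fin.consEquiv fun _ => Fin n), Fintype.sum_prod_type]
    rfl
  rw [Finset.sum_comm]
  simp [h1, h2]

theorem vecDetForm_comp_perm {k : ℕ} (w : Fin k → EuclideanSpace ℝ (Fin k))
    (σ : Equiv.Perm (Fin k)) :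
    vecDetForm k (w ∘ σ) = (Equiv.Perm.sign σ : ℤ) * vecDetForm k w := by
  have := (vecDetForm k).toAlternatingMap.map_perm w σ
  simp only [ContinuousAlternatingMap.coe_toAlternatingMap] at this
  rw [this, Units.smul_def, zsmul_eq_mul]

theorem sign_vecDetForm_mul_comp_perm {k : ℕ} (w w' : Fin k → EuclideanSpace ℝ (Fin k))
    (σ : Equiv.Perm (Fin k)) :
    Real.sign (vecDetForm k (w ∘ σ)) * vecDetForm k (w' ∘ σ) =
      Real.sign (vecDetForm k w) * vecDetForm k w' := by
  rw [vecDetForm_comp_perm, vecDetForm_comp_perm]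
  rcases Int.units_eq_one_or (Equiv.Perm.sign σ) with h | h <;> simp [h, Real.sign_neg]

theorem sign_vecDetForm_mul_update_swap {m : ℕ} (w : Fin (m + 1) → EuclideanSpace ℝ (Fin (m + 1)))
    (p : Fin (m + 1)) (x : EuclideanSpace ℝ (Fin (m + 1))) :
    Real.sign (vecDetForm _ (w ∘ Equiv.swap 0 p)) *
        vecDetForm _ (Function.update (w ∘ Equiv.swap 0 p) 0 x) =
      Real.sign (vecDetForm _ w) * vecDetForm _ (Function.update w p x) := by
  rw [← sign_vecDetForm_mul_comp_perm w (Function.update w p x) (Equiv.swap 0 p),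
    Function.update_comp_equiv]
  simp

/-- **Cramer's rule**. -/
theorem sum_vecDetForm_update_smul {k : ℕ} (w : Fin k → EuclideanSpace ℝ (Fin k))
    (x : EuclideanSpace ℝ (Fin k)) :
    ∑ p, vecDetForm k (Function.update w p x) • w p = vecDetForm k w • x := by
  have h := Matrix.mulVec_cramer (Matrix.of fun a b => w a b).transpose x.ofLp
  ext a
  have ha := congrFun h a
  simp only [Matrix.mulVec, dotProduct, Matrix.cramer_transpose_apply, Matrix.det_transpose,
    Pi.smul_apply, Matrix.transpose_apply, Matrix.of_apply] at ha
  simp only [vecDetForm_apply, WithLp.ofLp_sum, Finset.sum_apply, PiLp.smul_apply]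
  rw [← ha]
  refine Finset.sum_congr rfl fun p _ => ?_
  rw [smul_eq_mul, mul_comm]
  congr 2
  ext b c
  by_cases hb : b = p
  · subst hb
    simp
  · simp [hb]

section

variable {n m : ℕ}

theorem cons_comp_cons (v : Fin n → EuclideanSpace ℝ (Fin (m + 1))) (i : Fin n)
    (g : Fin m → Fin n) :
    v ∘ (Fin.cons i g : Fin (m + 1) → Fin n) = Fin.cons (v i) (v ∘ g) := by
  ext1 p
  refine Fin.cases ?_ (fun q => ?_) p <;> simp

/-- `m! F(S) ⟨σ_S(i), ∑_L det (x, v_L) e_L⟩` as a linear form in `x`. -/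
def signForm (v : Fin n → EuclideanSpace ℝ (Fin (m + 1))) (i : Fin n) :
    EuclideanSpace ℝ (Fin (m + 1)) →ₗ[ℝ] ℝ :=
  ∑ g : Fin m → Fin n, Real.sign (vecDetForm (m + 1) (Fin.cons (v i) (v ∘ g))) •
    (vecDetForm (m + 1)).toMultilinearMap.toLinearMap (Fin.cons 0 (v ∘ g)) 0

theorem signForm_apply (v : Fin n → EuclideanSpace ℝ (Fin (m + 1))) (i : Fin n)
    (x : EuclideanSpace ℝ (Fin (m + 1))) :
    signForm v i x = ∑ g : Fin m → Fin n,
      Real.sign (vecDetForm (m + 1) (Fin.cons (v i) (v ∘ g))) *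
        vecDetForm (m + 1) (Fin.cons x (v ∘ g)) := by
  simp [signForm, Fin.update_cons_zero]

/-- Groups the signed first variation by the index being varied. The weight `c` serves two uses: `c
= 1` for derivatives of the volume, `c i = ⟪v i, y⟫` for Cramer's rule. -/
theorem sum_sign_mul_sum_update (v : Fin n → EuclideanSpace ℝ (Fin (m + 1)))
    (y : Fin n → EuclideanSpace ℝ (Fin (m + 1))) (c : Fin n → ℝ) :
    ∑ f : Fin (m + 1) → Fin n, ∑ p, Real.sign (vecDetForm _ (v ∘ f)) *
        vecDetForm _ (Function.update (v ∘ f) p (y (f p))) * c (f p) =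
      (m + 1) * ∑ i, signForm v i (y i) * c i := by
  rw [sum_fun_sum_eq_of_swap]
  · congr 1
    refine Finset.sum_congr rfl fun i _ => ?_
    rw [signForm_apply, Finset.sum_mul]
    refine Finset.sum_congr rfl fun g _ => ?_
    rw [cons_comp_cons, Fin.cons_zero, Fin.update_cons_zero]
  · intro f p
    rw [← Function.comp_assoc, sign_vecDetForm_mul_update_swap]
    simp

/-- Cramer's rule collapses the inner sum to `det (v ∘ f) * ⟪x, y⟫`, and sign times determinant is
the absolute value summed in `(m + 1)! F`. Tightness plays no role. -/
theorem sum_signForm_mul_inner (v : Fin n → EuclideanSpace ℝ (Fin (m + 1)))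
    (x y : EuclideanSpace ℝ (Fin (m + 1))) :
    ∑ i, signForm v i x * ⟪v i, y⟫ = m.factorial * zonotopeVolume v * ⟪x, y⟫ := by
  have h := sum_sign_mul_sum_update v (fun _ => x) fun i => ⟪v i, y⟫
  have hm : ((m : ℝ) + 1) ≠ 0 := by positivity
  refine mul_left_cancel₀ hm ?_
  rw [← h, ← mul_assoc, ← mul_assoc]
  have hf : ((m : ℝ) + 1) * m.factorial = (m + 1).factorial := by
    rw [Nat.factorial_succ]
    push_cast
    ring
  rw [hf, factorial_mul_zonotopeVolume, Finset.sum_mul]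
  refine Finset.sum_congr rfl fun f _ => ?_
  have hc := congrArg (fun z => ⟪z, y⟫) (sum_vecDetForm_update_smul (v ∘ f) x)
  simp only [sum_inner, real_inner_smul_left] at hc
  simp_rw [mul_assoc]
  rw [← Finset.mul_sum]
  change _ * ∑ p, vecDetForm (m + 1) (Function.update (v ∘ f) p x) * ⟪(v ∘ f) p, y⟫ = _
  rw [hc, ← mul_assoc]
  congr 1
  rcases lt_trichotomy (vecDetForm (m + 1) (v ∘ f)) 0 with h | h | h
  · rw [Real.sign_of_neg h, abs_of_neg h]
    ring
  · simp [h]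
  · rw [Real.sign_of_pos h, abs_of_pos h]
    ring

/-- The rotation has velocity `v j` at `i` and `-v i` at `j`, so the vanishing signed variation is
exactly this symmetry. -/
theorem IsRotationMax.signForm_comm {v : Fin n → EuclideanSpace ℝ (Fin (m + 1))}
    (h : IsRotationMax v) (i j : Fin n) : signForm v i (v j) = signForm v j (v i) := by
  by_cases hij : i = j
  · rw [hij]
  have h1 := (h.first_order hij).2
  have h2 := sum_sign_mul_sum_update v (givensVelocity v i j) fun _ => 1
  simp only [mul_one, ← Finset.mul_sum, h1] at h2
  have hm : ((m : ℝ) + 1) ≠ 0 := by positivity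
  have h3 := (mul_eq_zero.1 h2.symm).resolve_left hm
  rw [Fintype.sum_eq_add i j hij] at h3
  · simp only [givensVelocity, if_true, if_neg (Ne.symm hij), map_neg] at h3
    linarith
  · rintro l ⟨hl, hl'⟩
    simp [givensVelocity, hl, hl']

/-- Expand `x` in the frame, exchange indices by symmetry, and sum by `sum_signForm_mul_inner`. -/
theorem IsRotationMax.signForm_eq {v : Fin n → EuclideanSpace ℝ (Fin (m + 1))}
    (h : IsRotationMax v) (hv : IsTightFrame v) (i : Fin n)
    (x : EuclideanSpace ℝ (Fin (m + 1))) :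
    signForm v i x = m.factorial * zonotopeVolume v * ⟪v i, x⟫ := by
  rw [← sum_signForm_mul_inner]
  conv_lhs => rw [← (isTightFrame_iff v).1 hv x]
  rw [map_sum]
  refine Finset.sum_congr rfl fun j _ => ?_
  rw [map_smul, h.signForm_comm i j, smul_eq_mul, mul_comm]

/-- Otherwise, expanding the standard basis in the frame multilinearly would give it determinant 0.
-/
theorem IsTightFrame.exists_vecDetForm_ne_zero {k : ℕ} {v : Fin n → EuclideanSpace ℝ (Fin k)}
    (hv : IsTightFrame v) : ∃ f : Fin k → Fin n, vecDetForm k (v ∘ f) ≠ 0 := by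
  by_contra! h0
  have h1 : vecDetForm k (fun a => EuclideanSpace.single a 1) = 1 := by
    rw [vecDetForm_apply, ← Matrix.det_one (n := Fin k)]
    congr 1
    ext a b
    simp [Matrix.one_apply, eq_comm]
  have h2 : vecDetForm k (fun a => EuclideanSpace.single a 1) = 0 := by
    have h3 : ∀ a : Fin k, (EuclideanSpace.single a (1 : ℝ)) =
        ∑ j, ⟪v j, EuclideanSpace.single a (1 : ℝ)⟫ • v j :=
      fun a => ((isTightFrame_iff v).1 hv _).symm
    rw [funext h3]
    have := (vecDetForm k).toMultilinearMap.map_sum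
      (g := fun (a : Fin k) (j : Fin n) => ⟪v j, EuclideanSpace.single a (1 : ℝ)⟫ • v j)
    refine this.trans (Finset.sum_eq_zero fun f _ => ?_)
    rw [MultilinearMap.map_smul_univ]
    refine smul_eq_zero_of_right _ (h0 f)
  rw [h1] at h2
  exact one_ne_zero h2

theorem IsTightFrame.zonotopeVolume_pos {k : ℕ} {v : Fin n → EuclideanSpace ℝ (Fin k)}
    (hv : IsTightFrame v) : 0 < zonotopeVolume v := by
  have h := factorial_mul_zonotopeVolume v
  have hpos : 0 < ∑ f : Fin k → Fin n, |vecDetForm k (v ∘ f)| := by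
    obtain ⟨f, hf⟩ := hv.exists_vecDetForm_ne_zero
    exact Finset.sum_pos' (fun _ _ => abs_nonneg _) ⟨f, Finset.mem_univ _, abs_pos.2 hf⟩
  rw [← h] at hpos
  exact pos_of_mul_pos_right hpos (by positivity)

end

/-! ### General position. -/

theorem vecDetForm_ne_zero_of_linearIndependent {k : ℕ} {w : Fin k → EuclideanSpace ℝ (Fin k)}
    (hw : LinearIndependent ℝ w) : vecDetForm k w ≠ 0 := by
  rw [vecDetForm_apply]
  have h : LinearIndependent ℝ (Matrix.of fun a b => w a b).row :=
    hw.map' (WithLp.linearEquiv 2 ℝ (Fin k → ℝ)).toLinearMap (LinearEquiv.ker _)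
  exact ((Matrix.isUnit_iff_isUnit_det _).1
    (Matrix.linearIndependent_rows_iff_isUnit.1 h)).ne_zero

/-- Rotating in the plane of `f p` and `j` moves only slot `p`, with velocity `v j`; the new minor
is therefore the velocity of a vanishing minor. -/
theorem IsRotationMax.exchange {n k : ℕ} {v : Fin n → EuclideanSpace ℝ (Fin k)}
    (h : IsRotationMax v) {f : Fin k → Fin n} (hf : Function.Injective f)
    (h0 : vecDetForm k (v ∘ f) = 0) (p : Fin k) {j : Fin n} (hj : j ∉ Set.range f) :
    vecDetForm k (v ∘ Function.update f p j) = 0 := by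
  have hne : f p ≠ j := fun h => hj ⟨p, h⟩
  have h1 := (h.first_order hne).1 f h0
  rw [Finset.sum_eq_single p] at h1
  · rw [Function.comp_update]
    simpa [givensVelocity] using h1
  · intro q _ hq
    rw [givensVelocity, if_neg fun h => hq (hf h), if_neg fun h => hj ⟨q, h⟩]
    exact (vecDetForm k).map_update_zero _ _
  · simp

theorem IsTightFrame.span_eq_top {n k : ℕ} {v : Fin n → EuclideanSpace ℝ (Fin k)}
    (hv : IsTightFrame v) : Submodule.span ℝ (Set.range v) = ⊤ := by
  refine eq_top_iff.2 fun x _ => ?_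
  rw [← (isTightFrame_iff v).1 hv x]
  exact Submodule.sum_mem _ fun i _ =>
    Submodule.smul_mem _ _ (Submodule.subset_span (Set.mem_range_self i))

theorem IsRotationMax.vecDetForm_ne_zero {n k : ℕ} {v : Fin n → EuclideanSpace ℝ (Fin k)}
    (h : IsRotationMax v) (hv : IsTightFrame v) (f : Fin k → Fin n) (hf : Function.Injective f) :
    vecDetForm k (v ∘ f) ≠ 0 := by
  intro h0
  -- Induction on the corank: trading a redundant `v (f p)` for a frame vector outside the span
  -- raises the rank while the minor stays zero.
  induction hr : k - Module.finrank ℝ (Submodule.span ℝ (Set.range (v ∘ f)))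
    using Nat.strong_induction_on generalizing f with
  | _ r ih =>
  subst hr
  have hdep : ¬ LinearIndependent ℝ (v ∘ f) :=
    fun hl => vecDetForm_ne_zero_of_linearIndependent hl h0
  have hspan : ∃ j, v j ∉ Submodule.span ℝ (Set.range (v ∘ f)) := by
    by_contra! hall
    refine hdep (linearIndependent_of_top_le_span_of_card_eq_finrank ?_ (by simp))
    rw [← hv.span_eq_top, Submodule.span_le]
    rintro _ ⟨j, rfl⟩
    exact hall j
  obtain ⟨j, hj⟩ := hspan
  have hjf : j ∉ Set.range f := by
    rintro ⟨p, rfl⟩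
    exact hj (Submodule.subset_span ⟨p, rfl⟩)
  rw [linearIndependent_iff_notMem_span] at hdep
  push Not at hdep
  obtain ⟨p, hp⟩ := hdep
  have hlt : Submodule.span ℝ (Set.range (v ∘ f)) <
      Submodule.span ℝ (Set.range (v ∘ Function.update f p j)) := by
    refine lt_of_le_of_ne ?_ fun he => hj ?_
    · have hsub : Submodule.span ℝ (v ∘ f '' (Set.univ \ {p})) ≤
          Submodule.span ℝ (Set.range (v ∘ Function.update f p j)) := by
        refine Submodule.span_mono ?_
        rintro _ ⟨q, hq, rfl⟩
        refine ⟨q, ?_⟩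
        simp [Function.update_of_ne (show q ≠ p by simpa using hq)]
      rw [Submodule.span_le]
      rintro _ ⟨q, rfl⟩
      by_cases hq : q = p
      · subst hq
        exact hsub hp
      · exact hsub (Submodule.subset_span ⟨q, by simpa using hq, rfl⟩)
    · rw [he]
      exact Submodule.subset_span ⟨p, by simp⟩
  have hrank := Submodule.finrank_lt_finrank_of_lt hlt
  -- The bound by `k` makes the truncated subtraction strictly decrease.
  have hle := Submodule.finrank_le (Submodule.span ℝ (Set.range (v ∘ Function.update f p j)))
  rw [finrank_euclideanSpace_fin] at hle
  refine ih _ (by omega) (Function.update f p j) ?_ (h.exchange hf h0 p hjf) rfl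
  intro a b hab
  by_cases ha : a = p <;> by_cases hb : b = p
  · rw [ha, hb]
  · subst ha
    rw [Function.update_self, Function.update_of_ne hb] at hab
    exact absurd ⟨b, hab.symm⟩ hjf
  · subst hb
    rw [Function.update_self, Function.update_of_ne ha] at hab
    exact absurd ⟨a, hab⟩ hjf
  · rw [Function.update_of_ne ha, Function.update_of_ne hb] at hab
    exact hf hab

/-! ### The exterior power of the projection and the system. -/

section

variable {n m : ℕ}

theorem vecDetForm_cons_sum {ι : Type*} (s : Finset ι) (c : ι → ℝ)
    (y : ι → EuclideanSpace ℝ (Fin (m + 1))) (w : Fin m → EuclideanSpace ℝ (Fin (m + 1))) :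
    vecDetForm (m + 1) (Fin.cons (∑ i ∈ s, c i • y i) w) =
      ∑ i ∈ s, c i * vecDetForm (m + 1) (Fin.cons (y i) w) := by
  let φ := (vecDetForm (m + 1)).toMultilinearMap.toLinearMap (Fin.cons 0 w) 0
  have hφ : ∀ x, φ x = vecDetForm (m + 1) (Fin.cons x w) := by
    intro x
    simp [φ, Fin.update_cons_zero]
  simp_rw [← hφ, map_sum, map_smul, smul_eq_mul]

theorem vecDetForm_mul_vecDetForm {k : ℕ} (u w : Fin k → EuclideanSpace ℝ (Fin k)) :
    vecDetForm k u * vecDetForm k w = Matrix.det (Matrix.of fun i j => ⟪u j, w i⟫) := by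
  rw [vecDetForm_apply, vecDetForm_apply, mul_comm, ← Matrix.det_transpose (Matrix.of fun a b => u a b),
    ← Matrix.det_mul]
  congr 1

/-- For a tight frame in dimension `m + 1`, the Gram determinant of two families of `m` vectors
is the inner product of their generalized cross products. -/
theorem IsTightFrame.det_inner_eq_sum {v : Fin n → EuclideanSpace ℝ (Fin (m + 1))}
    (hv : IsTightFrame v) (u w : Fin m → EuclideanSpace ℝ (Fin (m + 1))) :
    Matrix.det (Matrix.of fun i j => ⟪u j, w i⟫) =
      ∑ l, vecDetForm (m + 1) (Fin.cons (v l) w) * vecDetForm (m + 1) (Fin.cons (v l) u) := by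
  rw [← vecDetForm_cons_sum]
  -- `c` is the generalized cross product of `w`: pairing it with `x` gives `det (x, w)`, so it is
  -- orthogonal to each `w i`.
  set c : EuclideanSpace ℝ (Fin (m + 1)) :=
    ∑ l, vecDetForm (m + 1) (Fin.cons (v l) w) • v l with hc
  have hcx : ∀ x, ⟪c, x⟫ = vecDetForm (m + 1) (Fin.cons x w) := by
    intro x
    conv_rhs => rw [← (isTightFrame_iff v).1 hv x]
    rw [vecDetForm_cons_sum, hc, sum_inner]
    simp_rw [real_inner_smul_left, mul_comm]
  have hcw : ∀ i, ⟪c, w i⟫ = 0 := by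
    intro i
    rw [hcx]
    exact (vecDetForm (m + 1)).map_eq_zero_of_eq (i := 0) (j := i.succ) _ (by simp)
      (Fin.succ_ne_zero i).symm
  -- If `c = 0`, then `w` is dependent and both sides vanish. Otherwise the Gram determinant of `(c,
  -- u)` and `(c, w)` factors as `⟪c, c⟫` times the wanted one, while `det (c, w) = ⟪c, c⟫` cancels.
  by_cases h0 : c = 0
  · have h1 : vecDetForm (m + 1) (Fin.cons c u) = 0 := by
      rw [h0]
      exact (vecDetForm (m + 1)).map_coord_zero 0 (by simp)
    rw [h1]
    have hdep : ¬ LinearIndependent ℝ w := by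
      intro hw
      obtain ⟨x, hx⟩ : ∃ x, x ∉ Submodule.span ℝ (Set.range w) := by
        by_contra! hall
        have htop : Submodule.span ℝ (Set.range w) = ⊤ := eq_top_iff.2 fun x _ => hall x
        have := finrank_range_le_card (R := ℝ) w
        rw [Set.finrank, htop, finrank_top, finrank_euclideanSpace_fin, Fintype.card_fin] at this
        omega
      refine vecDetForm_ne_zero_of_linearIndependent (hw.finCons hx) ?_
      rw [← hcx, h0, inner_zero_left]
    have hrow : ¬ LinearIndependent ℝ (Matrix.of fun i j => ⟪u j, w i⟫).row := by
      intro hl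
      refine hdep (LinearIndependent.of_comp
        (LinearMap.pi fun j => (innerₗ (EuclideanSpace ℝ (Fin (m + 1))) (u j))) ?_)
      exact hl
    by_contra hne
    exact hrow (Matrix.linearIndependent_rows_iff_isUnit.2
      ((Matrix.isUnit_iff_isUnit_det _).2 (isUnit_iff_ne_zero.2 hne)))
  · have hcc : ⟪c, c⟫ ≠ 0 := fun h => h0 (inner_self_eq_zero.1 h)
    have h1 := vecDetForm_mul_vecDetForm (Fin.cons c u) (Fin.cons c w)
    rw [← hcx c, Matrix.det_succ_column_zero, Fin.sum_univ_succ, Finset.sum_eq_zero, add_zero] at h1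
    · refine mul_right_cancel₀ hcc (Eq.trans ?_ h1.symm)
      simp only [Fin.val_zero, pow_zero, one_mul, Matrix.of_apply, Fin.cons_zero]
      rw [mul_comm]
      rfl
    · intro i _
      simp [hcw]

/-- Tightness makes the rows orthonormal, so the projection has the Gram matrix of the frame as its
matrix. -/
theorem rowProj_single {k : ℕ} {v : Fin n → EuclideanSpace ℝ (Fin k)} (hv : IsTightFrame v)
    (b : Fin n) :
    rowProj v (EuclideanSpace.single b 1) = WithLp.toLp 2 fun i => ⟪v i, v b⟫ := by
  refine Submodule.eq_starProjection_of_mem_orthogonal ?_ ?_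
  · have : (WithLp.toLp 2 fun i => ⟪v i, v b⟫ : EuclideanSpace ℝ (Fin n)) =
        ∑ a, v b a • WithLp.toLp 2 fun i : Fin n => v i a := by
      ext i
      simp [PiLp.inner_apply]
    rw [this]
    exact Submodule.sum_mem _ fun a _ =>
      Submodule.smul_mem _ _ (Submodule.subset_span (Set.mem_range_self a))
  · rw [rowSpace, Submodule.mem_orthogonal]
    intro u hu
    induction hu using Submodule.span_induction with
    | mem u hu =>
      obtain ⟨a, rfl⟩ := hu
      have h := congrArg (fun x => x a) ((isTightFrame_iff v).1 hv (v b))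
      simp only [WithLp.ofLp_sum, Finset.sum_apply, PiLp.smul_apply, smul_eq_mul] at h
      rw [inner_sub_right, EuclideanSpace.inner_single_right, PiLp.inner_apply]
      simp [h]
    | zero => simp
    | add x y _ _ hx hy => rw [inner_add_left, hx, hy, add_zero]
    | smul c x _ hx => rw [real_inner_smul_left, hx, mul_zero]

theorem stdExtBasis_apply (L : Set.powersetCard (Fin n) m) :
    stdExtBasis n m L = exteriorPower.ιMulti ℝ m
      (fun a => EuclideanSpace.single (Set.powersetCard.ofFinEmbEquiv.symm L a) (1 : ℝ)) := by
  rw [stdExtBasis, ← OrthonormalBasis.coe_toBasis, OrthonormalBasis.toBasis_exteriorPower,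
    exteriorPower.coe_basis, exteriorPower.ιMulti_family]
  congr 1
  ext1 a
  simp

theorem frameDet_eq (v : Fin n → EuclideanSpace ℝ (Fin (m + 1))) (i : Fin n)
    (L : Set.powersetCard (Fin n) m) :
    frameDet v i L =
      vecDetForm (m + 1) (Fin.cons (v i) (v ∘ Set.powersetCard.ofFinEmbEquiv.symm L)) :=
  vecDet_eq_vecDetForm _

/-- The matrix entries of the exterior power are Gram determinants, which
`IsTightFrame.det_inner_eq_sum` splits into products of frame determinants. -/
theorem map_rowProj_stdExtBasis {v : Fin n → EuclideanSpace ℝ (Fin (m + 1))}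
    (hv : IsTightFrame v) (L : Set.powersetCard (Fin n) m) :
    exteriorPower.map m (rowProj v) (stdExtBasis n m L) = ∑ j, frameDet v j L • dVec v j := by
  refine (stdExtBasis n m).toBasis.ext_elem fun L' => ?_
  have h1 : ∀ j, (stdExtBasis n m).toBasis.repr (dVec v j) L' = frameDet v j L' := by
    intro j
    rw [dVec, ← OrthonormalBasis.coe_toBasis, Module.Basis.repr_sum_self]
  simp only [map_sum, map_smul, Finsupp.coe_finsetSum, Finset.sum_apply, Finsupp.smul_apply,
    smul_eq_mul, h1, frameDet_eq]
  rw [OrthonormalBasis.coe_toBasis_repr_apply, OrthonormalBasis.repr_apply_apply,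
    stdExtBasis_apply L, exteriorPower.map_apply_ιMulti, stdExtBasis_apply L',
    exteriorPower.inner_ιMulti_ιMulti, ← hv.det_inner_eq_sum]
  congr 1
  ext a b
  simp [rowProj_single hv, EuclideanSpace.inner_single_left]

theorem inner_sigmaVec_dVec (v : Fin n → EuclideanSpace ℝ (Fin (m + 1))) (i j : Fin n) :
    ⟪sigmaVec v i, dVec v j⟫ =
      ∑ L, Real.sign (frameDet v i L) / zonotopeVolume v * frameDet v j L := by
  rw [sigmaVec, dVec, (stdExtBasis n m).orthonormal.inner_sum]
  simp

theorem factorial_mul_inner_sigmaVec_dVec (v : Fin n → EuclideanSpace ℝ (Fin (m + 1)))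
    (i j : Fin n) :
    m.factorial * ⟪sigmaVec v i, dVec v j⟫ = signForm v i (v j) / zonotopeVolume v := by
  rw [signForm_apply, sum_fun_eq_factorial_mul_sum_powersetCard, inner_sigmaVec_dVec,
    mul_div_assoc, Finset.sum_div]
  · congr 1
    refine Finset.sum_congr rfl fun L _ => ?_
    rw [frameDet_eq, frameDet_eq]
    ring
  · intro g hg
    have : ¬ Function.Injective (Fin.cons i g : Fin (m + 1) → Fin n) :=
      fun h => hg (Fin.cons_injective_iff.1 h).2
    rw [← cons_comp_cons, vecDetForm_comp_eq_zero v this, Real.sign_zero, zero_mul]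
  · intro g σ
    -- `decomposeFin.symm (0, σ)` is `σ` acting on the successors and fixing `0`.
    have : ∀ x : EuclideanSpace ℝ (Fin (m + 1)), (Fin.cons x (v ∘ g ∘ σ) : Fin (m + 1) → _) =
        (Fin.cons x (v ∘ g) : Fin (m + 1) → EuclideanSpace ℝ (Fin (m + 1))) ∘
          Equiv.Perm.decomposeFin.symm (0, σ) := by
      intro x
      ext1 p
      refine Fin.cases ?_ (fun q => ?_) p <;> simp
    rw [this, this, sign_vecDetForm_mul_comp_perm]

theorem map_rowProj_sigmaVec {v : Fin n → EuclideanSpace ℝ (Fin (m + 1))}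
    (hv : IsTightFrame v) (i : Fin n) :
    exteriorPower.map m (rowProj v) (sigmaVec v i) =
      ∑ j, ⟪sigmaVec v i, dVec v j⟫ • dVec v j := by
  rw [sigmaVec, map_sum]
  simp_rw [map_smul, map_rowProj_stdExtBasis hv, Finset.smul_sum]
  rw [Finset.sum_comm]
  refine Finset.sum_congr rfl fun j _ => ?_
  rw [← sigmaVec, inner_sigmaVec_dVec, Finset.sum_smul]
  simp_rw [smul_smul]

/-- `dVec` is linear in the distinguished vector, so this is the frame expansion of `v i`. It
reduces the first equation of the system to the second. -/
theorem IsTightFrame.sum_inner_smul_dVec {v : Fin n → EuclideanSpace ℝ (Fin (m + 1))}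
    (hv : IsTightFrame v) (i : Fin n) : ∑ j, ⟪v i, v j⟫ • dVec v j = dVec v i := by
  simp_rw [dVec, Finset.smul_sum]
  rw [Finset.sum_comm]
  refine Finset.sum_congr rfl fun L _ => ?_
  simp_rw [smul_smul]
  rw [← Finset.sum_smul]
  congr 1
  simp_rw [frameDet_eq]
  rw [← vecDetForm_cons_sum]
  congr 2
  conv_rhs => rw [← (isTightFrame_iff v).1 hv (v i)]
  simp_rw [real_inner_comm]

theorem IsRotationMax.sigmaSystem {v : Fin n → EuclideanSpace ℝ (Fin (m + 1))}
    (h : IsRotationMax v) (hv : IsTightFrame v) : SigmaSystem v := by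
  have h2 : ∀ i j, ⟪sigmaVec v i, dVec v j⟫ = ⟪v i, v j⟫ := by
    intro i j
    have hF := hv.zonotopeVolume_pos.ne'
    have hm : (m.factorial : ℝ) ≠ 0 := by positivity
    refine mul_left_cancel₀ hm ?_
    rw [factorial_mul_inner_sigmaVec_dVec, h.signForm_eq hv]
    field_simp
  refine ⟨fun i => ?_, h2⟩
  rw [map_rowProj_sigmaVec hv]
  simp_rw [h2]
  exact hv.sum_inner_smul_dVec i

theorem IsRotationMax.inGeneralPosition {k : ℕ} {v : Fin n → EuclideanSpace ℝ (Fin k)}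
    (h : IsRotationMax v) (hv : IsTightFrame v) : InGeneralPosition v := by
  intro L
  rw [vecDet_eq_vecDetForm]
  exact h.vecDetForm_ne_zero hv _ (Set.powersetCard.ofFinEmbEquiv.symm L).injective

/-! ### The converse: the system implies stationarity. -/

theorem InGeneralPosition.vecDetForm_ne_zero {k : ℕ} {v : Fin n → EuclideanSpace ℝ (Fin k)}
    (h : InGeneralPosition v) {f : Fin k → Fin n} (hf : Function.Injective f) :
    vecDetForm k (v ∘ f) ≠ 0 := by
  let L : Set.powersetCard (Fin n) k := Set.powersetCard.ofFinEmb k (Fin n) ⟨f, hf⟩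
  have hmem : ∀ b, f b ∈ L.1 := by simp [L]
  have h1 := absDet_eq_of_injective (fun i => (v i).ofLp) L.2 hf hmem
  have h2 := absDet_eq_of_injective (fun i => (v i).ofLp) L.2
    (Set.powersetCard.ofFinEmbEquiv.symm L).injective fun b => Finset.orderEmbOfFin_mem L.1 L.2 b
  have h3 := h L
  rw [vecDet_eq_vecDetForm] at h3
  have h4 : |vecDetForm k (v ∘ f)| =
      |vecDetForm k (v ∘ Set.powersetCard.ofFinEmbEquiv.symm L)| := h1.symm.trans h2
  rw [← abs_ne_zero] at h3 ⊢
  rwa [h4]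

theorem IsTightFrame.sum_norm_sq {k : ℕ} {v : Fin n → EuclideanSpace ℝ (Fin k)}
    (hv : IsTightFrame v) : ∑ i, ‖v i‖ ^ 2 = k := by
  simp_rw [EuclideanSpace.real_norm_sq_eq]
  rw [Finset.sum_comm]
  have : ∀ a : Fin k, ∑ i, v i a ^ 2 = 1 := by
    intro a
    have h := congrArg (fun x => x a) ((isTightFrame_iff v).1 hv (EuclideanSpace.single a 1))
    simpa [EuclideanSpace.inner_single_right, pow_two] using h
  simp [this]

/-- Minors with distinct indices avoid the kink of the absolute value; those with a repeated index
vanish identically. -/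
theorem InGeneralPosition.hasFDerivAt_zonotopeVolume {k : ℕ}
    {v : Fin n → EuclideanSpace ℝ (Fin k)} (h : InGeneralPosition v) :
    HasFDerivAt zonotopeVolume ((k.factorial : ℝ)⁻¹ • ∑ f : Fin k → Fin n,
      Real.sign (vecDetForm k (v ∘ f)) •
        ((vecDetForm k).toContinuousMultilinearMap.linearDeriv (v ∘ f)).comp
          (ContinuousLinearMap.pi fun p => ContinuousLinearMap.proj (f p))) v := by
  have hF : (zonotopeVolume : (Fin n → EuclideanSpace ℝ (Fin k)) → ℝ) =
      fun w => (k.factorial : ℝ)⁻¹ • ∑ f : Fin k → Fin n, |vecDetForm k (w ∘ f)| := by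
    ext w
    rw [← factorial_mul_zonotopeVolume, smul_eq_mul, inv_mul_cancel_left₀ (by positivity)]
  rw [hF]
  refine (HasFDerivAt.fun_sum (u := Finset.univ) fun f _ => ?_).const_smul (k.factorial : ℝ)⁻¹
  have hd := hasFDerivAt_vecDetForm_comp v f
  by_cases hf : Function.Injective f
  · rcases lt_or_gt_of_ne (h.vecDetForm_ne_zero hf) with h1 | h1
    · rw [Real.sign_of_neg h1]
      exact (hasDerivAt_abs_neg h1).comp_hasFDerivAt v hd
    · rw [Real.sign_of_pos h1]
      exact (hasDerivAt_abs_pos h1).comp_hasFDerivAt v hd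
  · simp_rw [vecDetForm_comp_eq_zero _ hf, Real.sign_zero, zero_smul, abs_zero]
    exact hasFDerivAt_const _ _

theorem SigmaSystem.signForm_eq {v : Fin n → EuclideanSpace ℝ (Fin (m + 1))}
    (h : SigmaSystem v) (hv : IsTightFrame v) (i : Fin n)
    (x : EuclideanSpace ℝ (Fin (m + 1))) :
    signForm v i x = m.factorial * zonotopeVolume v * ⟪v i, x⟫ := by
  have h1 : ∀ j, signForm v i (v j) = m.factorial * zonotopeVolume v * ⟪v i, v j⟫ := by
    intro j
    have hF := hv.zonotopeVolume_pos.ne'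
    rw [← h.2, mul_right_comm, factorial_mul_inner_sigmaVec_dVec]
    field_simp
  conv_lhs => rw [← (isTightFrame_iff v).1 hv x]
  conv_rhs => rw [← (isTightFrame_iff v).1 hv x]
  rw [map_sum, inner_sum, Finset.mul_sum]
  refine Finset.sum_congr rfl fun j _ => ?_
  rw [map_smul, h1, real_inner_smul_right, smul_eq_mul]
  ring

theorem SigmaSystem.hasFDerivWithinAt {v : Fin n → EuclideanSpace ℝ (Fin (m + 1))}
    (h : SigmaSystem v) (hv : IsTightFrame v) (hg : InGeneralPosition v) :
    HasFDerivWithinAt zonotopeVolume (0 : (Fin n → EuclideanSpace ℝ (Fin (m + 1))) →L[ℝ] ℝ)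
      (tightFrames n (m + 1)) v := by
  have hN : HasFDerivAt (fun w : Fin n → EuclideanSpace ℝ (Fin (m + 1)) => ∑ i, ‖w i‖ ^ 2)
      (∑ i, 2 • (innerSL ℝ (v i)).comp (ContinuousLinearMap.proj i)) v :=
    HasFDerivAt.fun_sum fun i _ => (hasFDerivAt_apply i v).norm_sq
  -- `zonotopeVolume v / 2` acts as a Lagrange multiplier: the subtracted term vanishes on tight
  -- frames, and the difference has zero derivative in every ambient direction, so no tangent space
  -- is needed.
  have hH := hg.hasFDerivAt_zonotopeVolume.sub
    ((hN.sub_const ((m + 1 : ℕ) : ℝ)).const_smul (zonotopeVolume v / 2))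
  have hz : ∀ w ∈ tightFrames n (m + 1), ∑ i, ‖w i‖ ^ 2 - ((m + 1 : ℕ) : ℝ) = 0 := by
    intro w hw
    rw [IsTightFrame.sum_norm_sq hw, sub_self]
  refine (hH.hasFDerivWithinAt.congr (fun w hw => ?_) ?_).congr_fderiv ?_
  · simp only [Pi.sub_apply, Pi.smul_apply, hz w hw, smul_zero, sub_zero]
  · simp only [Pi.sub_apply, Pi.smul_apply, hz v hv, smul_zero, sub_zero]
  · ext y
    have h1 := sum_sign_mul_sum_update v y fun _ => 1
    simp_rw [mul_one, h.signForm_eq hv, ← Finset.mul_sum] at h1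
    simp only [sub_apply, smul_apply, sum_apply, ContinuousLinearMap.comp_apply, smul_eq_mul,
      ContinuousMultilinearMap.linearDeriv_apply, innerSL_apply_apply, zero_apply,
      ContinuousLinearMap.proj_apply, nsmul_eq_mul, ContinuousLinearMap.pi_apply,
      ContinuousAlternatingMap.coe_toContinuousMultilinearMap, ← Finset.mul_sum]
    rw [h1, Nat.factorial_succ]
    have hm : (m.factorial : ℝ) ≠ 0 := by positivity
    push_cast
    field_simp
    ring

end

end

/-- Families carry the sup norm, equivalent to the ℓ² distance in finite dimension, so a zero
derivative within the tight frames is the `o(dist)` condition. Writing `k = m + 1` encodes `1 ≤ k`;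
tightness forces `k ≤ n`. -/
theorem mainTheorem4 (n m : ℕ) (v : Fin n → EuclideanSpace ℝ (Fin (m + 1)))
    (hv : IsTightFrame v) :
    (IsLocalMaxOn zonotopeVolume (tightFrames n (m + 1)) v → SigmaSystem v) ∧
      (HasFDerivWithinAt zonotopeVolume
          (0 : (Fin n → EuclideanSpace ℝ (Fin (m + 1))) →L[ℝ] ℝ) (tightFrames n (m + 1)) v ↔
        InGeneralPosition v ∧ SigmaSystem v) :=
  ⟨fun h => (hv.isRotationMax_of_isLocalMaxOn h).sigmaSystem hv,
    fun h => ⟨(hv.isRotationMax_of_hasFDerivWithinAt h).inGeneralPosition hv,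
      (hv.isRotationMax_of_hasFDerivWithinAt h).sigmaSystem hv⟩,
    fun h => h.2.hasFDerivWithinAt hv h.1⟩
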